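/- Let $G$ be a countable discrete group. For a map $\sigma:G\to\mathrm{Sym}(m)$ ($m\ge 1$, $\sigma$ not necessarily a homomorphism) and $F\subset G$, let $V(F)\subset\{1,\dots,m\}$ be the set of all $v$ such that $\sigma(f_1)\sigma(f_2)v=\sigma(f_1f_2)v$ for all $f_1,f_2\in F$ and $\sigma(f_1)v\neq\sigma(f_2)v$ for all distinct $f_1,f_2\in F$; $\sigma$ is an $(F,\epsilon)$-approximation to $G$ if $|V(F)|\ge(1-\epsilon)m$. The group $G$ is sofic if there are maps $\sigma_i:G\to\mathrm{Sym}(m_i)$, sets $F_1\subset F_2\subset\cdots$ with $\bigcup_i F_i=G$, and reals $\epsilon_i\to 0$ such that each $\sigma_i$ is an $(F_i,\epsilon_i)$-approximation to $G$. For a standard Borel probability space $(K,\kappa)$, the Bernoulli shift $(G,K^G,\kappa^G)$ is the action $(gx)(f)=x(g^{-1}f)$ of $G$ on $K^G$ with the product measure $\kappa^G$. The base entropy of $\kappa$ is $H(\kappa)=-\sum_{k\in K'}\kappa(\{k\})\log\kappa(\{k\})\in[0,+\infty]$ (with $0\log 0=0$) if there is a countable $K'\subset K$ with $\kappa(K')=1$,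 and $H(\kappa)=+\infty$ otherwise. Two probability-measure-preserving systems $(G_1,X_1,\mu_1)$, $(G_2,X_2,\mu_2)$ are conjugate up to automorphisms if there are a group isomorphism $\Phi:G_1\to G_2$, conull measurable sets $X_i'\subset X_i$ with $X_1'$ invariant under $G_1$, and a measure-space isomorphism $\phi:X_1'\to X_2'$ such that $\phi(gx)=\Phi(g)\phi(x)$ for all $g\in G_1$, $x\in X_1'$. If $G_1=G_2$ and $\Phi$ can be taken to be the identity, the systems are isomorphic. The group $G$ is Ornstein if, for any two standard Borel probability spaces $(K,\kappa)$, $(L,\lambda)$ with $H(\kappa)=H(\lambda)$, the systems $(G,K^G,\kappa^G)$ and $(G,L^G,\lambda^G)$ are isomorphic. Theorem. Let $G$ be a countable sofic Ornstein group and let $(K_1,\kappa_1)$, $(K_2,\kappa_2)$ be standard Borel probability spaces. Then $(G,K_1^G,\kappa_1^G)$ is conjugate up to automorphisms to $(G,K_2^G,\kappa_2^G)$ if and only if $H(\kappa_1)=H(\kappa_2)$ (where either entropy may be $+\infty$). -/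

import Mathlib

open MeasureTheory Filter Topology
open scoped ENNReal

namespace SoficBernoulli

/-! ### Sofic groups -/

/-- The set `V(F)` of points of `{1, …, m}` at which `σ` looks like a free action on `F`. -/
def goodPoints {G : Type*} [Group G] {m : ℕ} (σ : G → Equiv.Perm (Fin m)) (F : Set G) :
    Set (Fin m) :=
  {v | (∀ f₁ ∈ F, ∀ f₂ ∈ F, σ f₁ (σ f₂ v) = σ (f₁ * f₂) v) ∧
    ∀ f₁ ∈ F, ∀ f₂ ∈ F, f₁ ≠ f₂ → σ f₁ v ≠ σ f₂ v}

/-- `σ : G → Sym(m)` (an arbitrary map) is an `(F, ε)`-approximation to `G`. -/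
def IsApproximation {G : Type*} [Group G] {m : ℕ} (σ : G → Equiv.Perm (Fin m)) (F : Set G)
    (ε : ℝ) : Prop :=
  (1 - ε) * (m : ℝ) ≤ ((goodPoints σ F).ncard : ℝ)

/-- The sequence of maps `σ i : G → Sym(m i)` is a sofic approximation to `G`. -/
def IsSoficApproximation {G : Type*} [Group G] (m : ℕ → ℕ)
    (σ : (i : ℕ) → G → Equiv.Perm (Fin (m i))) : Prop :=
  (∀ i, 1 ≤ m i) ∧
  ∃ (F : ℕ → Set G) (ε : ℕ → ℝ),
    (∀ i, F i ⊆ F (i + 1)) ∧ (⋃ i, F i) = Set.univ ∧ Tendsto ε atTop (𝓝 0) ∧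
      ∀ i, IsApproximation (σ i) (F i) (ε i)

/-- `G` is sofic if it admits a sofic approximation. -/
def IsSofic (G : Type*) [Group G] : Prop :=
  ∃ (m : ℕ → ℕ) (σ : (i : ℕ) → G → Equiv.Perm (Fin (m i))), IsSoficApproximation m σ

/-! ### Conjugacy of systems -/

/-- A measure-space isomorphism between conull sets that intertwines the two actions along the
group isomorphism `Φ`. For `φ (g x)` to make sense the conull set `X₁'` has to be invariant. -/
def ConjugateAlong {G₁ G₂ X₁ X₂ : Type*} [Group G₁] [Group G₂] [MulAction G₁ X₁]
    [MulAction G₂ X₂] [MeasurableSpace X₁] [MeasurableSpace X₂] (Φ : G₁ ≃* G₂)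
    (μ₁ : Measure X₁) (μ₂ : Measure X₂) : Prop :=
  ∃ (X₁' : Set X₁) (X₂' : Set X₂) (φ : X₁' ≃ᵐ X₂'),
    MeasurableSet X₁' ∧ MeasurableSet X₂' ∧ μ₁ X₁'ᶜ = 0 ∧ μ₂ X₂'ᶜ = 0 ∧
    MeasurePreserving φ (μ₁.comap Subtype.val) (μ₂.comap Subtype.val) ∧
    ∀ (g : G₁) (x : X₁'), ∃ h : g • (x : X₁) ∈ X₁',
      ((φ ⟨g • (x : X₁), h⟩ : X₂') : X₂) = Φ g • ((φ x : X₂') : X₂)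

/-- Isomorphism (measure conjugacy) of two systems over the same group `G`. -/
def Isomorphic (G : Type*) {X₁ X₂ : Type*} [Group G] [MulAction G X₁] [MulAction G X₂]
    [MeasurableSpace X₁] [MeasurableSpace X₂] (μ₁ : Measure X₁) (μ₂ : Measure X₂) : Prop :=
  ConjugateAlong (MulEquiv.refl G) μ₁ μ₂

/-- The systems `(G₁, X₁, μ₁)` and `(G₂, X₂, μ₂)` are conjugate up to automorphisms. -/
def ConjugateUpToAutomorphisms (G₁ G₂ : Type*) {X₁ X₂ : Type*} [Group G₁] [Group G₂]
    [MulAction G₁ X₁] [MulAction G₂ X₂] [MeasurableSpace X₁] [MeasurableSpace X₂]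
    (μ₁ : Measure X₁) (μ₂ : Measure X₂) : Prop :=
  ∃ Φ : G₁ ≃* G₂, ConjugateAlong Φ μ₁ μ₂

/-! ### Bernoulli shifts -/

/-- The space `K^G` of all functions `G → K`. -/
def BernoulliSpace (G K : Type*) : Type _ := G → K

/-- The product Borel structure on `K^G`. -/
instance (G K : Type*) [MeasurableSpace K] : MeasurableSpace (BernoulliSpace G K) :=
  inferInstanceAs (MeasurableSpace (G → K))

/-- The shift action `(g x)(f) = x(g⁻¹ f)` of `G` on `K^G`. -/
instance (G K : Type*) [Group G] : MulAction G (BernoulliSpace G K) where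
  smul g x := fun f : G => x (g⁻¹ * f)
  one_smul x := funext fun f : G => congrArg x (by simp)
  mul_smul g h x := funext fun f : G => congrArg x (by simp [mul_assoc])

/-- The product measure `κ^G` on `K^G`. -/
noncomputable def bernoulliMeasure (G : Type*) {K : Type*} [MeasurableSpace K] (κ : Measure K) :
    Measure (BernoulliSpace G K) :=
  Measure.infinitePi (fun _ : G => κ)

open Classical in
/-- The entropy `H(κ)`: if `κ` is carried by a countable set it is `-∑ κ({k}) log κ({k})`
(a sum of nonnegative terms, possibly infinite; points outside a countable carrier have mass zero
and contribute nothing), and otherwise it is `+∞`. -/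
noncomputable def baseEntropy {K : Type*} [MeasurableSpace K] (κ : Measure K) : ℝ≥0∞ :=
  if ∃ K' : Set K, K'.Countable ∧ κ K' = 1 then
    ∑' k : K, ENNReal.ofReal (Real.negMulLog (κ.real {k}))
  else ⊤

/-- `G` is an Ornstein group: Bernoulli shifts over `G` whose base spaces are standard Borel
probability spaces of equal entropy are isomorphic. As every standard Borel space is Borel
isomorphic to a Borel subset of `ℝ`, quantifying over base spaces in `Type` loses nothing. -/
def IsOrnstein (G : Type*) [Group G] : Prop :=
  ∀ (K L : Type) [MeasurableSpace K] [MeasurableSpace L] [StandardBorelSpace K]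
    [StandardBorelSpace L] (κ : Measure K) (lam : Measure L) [IsProbabilityMeasure κ]
    [IsProbabilityMeasure lam],
    baseEntropy κ = baseEntropy lam →
      Isomorphic G (bernoulliMeasure G κ) (bernoulliMeasure G lam)

end SoficBernoulli

/-!
The forward direction rests on an inequality `H(q) ≤ H(κ₂)` for every finite-valued map `q` on `K₁`,
proved by coding on a sofic model. Label the `m` points of the model independently with law `κ₁`.
Reading the `K₂`-coordinate at the identity through finitely many bits and finitely many coordinates
of the configuration gives each point a `K₂`-label; since the conjugacy is invertible, the `q`-value
of a point is recovered from finitely many nearby `K₂`-labels, up to a rare error. Locally the model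
looks like `G` except at a small fraction of its points, so the `q`-values, of joint entropy exactly
`m * H(q)`, can be described by the `K₂`-labels, encoded without memory at a mean cost of about
`H(κ₂)` per point, followed by corrections of the recovered values, at a cost per point that tends
to `0` with the probability of an error. Gibbs' inequality for this description gives the bound.
Since `H(κ₁)` is the supremum of `H(q)` over finite partitions, infinite entropies are covered. An
automorphism of `G` merely relabels the coordinates of the second shift.

The Ornstein property concerns base spaces in one universe; it extends to all of them because every
standard Borel space is isomorphic to a measurable subset of `ℝ`.
-/

namespace SoficBernoulli

open scoped Pointwise

/-! ### Entropy -/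

/-- The information content `-log p` of an event of probability `p`, equal to `∞` at `p = 0`.
Values `p > 1`, where `-log p` is negative, are sent to `0`. -/
noncomputable def infoContent (p : ℝ≥0∞) : ℝ≥0∞ := (-ENNReal.log p).toENNReal

lemma infoContent_antitone : Antitone infoContent := fun _ _ h =>
  EReal.toENNReal_le_toENNReal (EReal.neg_le_neg_iff.2 (ENNReal.log_monotone h))

lemma continuous_infoContent : Continuous infoContent :=
  EReal.continuous_toENNReal.comp (continuous_neg.comp ENNReal.continuous_log)

@[simp] lemma infoContent_zero : infoContent 0 = ⊤ := by simp [infoContent]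

@[simp] lemma infoContent_one : infoContent 1 = 0 := by simp [infoContent]

lemma infoContent_of_ne {p : ℝ≥0∞} (h0 : p ≠ 0) (h1 : p ≠ ⊤) :
    infoContent p = ENNReal.ofReal (-Real.log p.toReal) := by
  rw [infoContent, ENNReal.log_pos_real h0 h1, ← EReal.coe_neg,
    EReal.toENNReal_of_ne_top (EReal.coe_ne_top _), EReal.toReal_coe]

lemma infoContent_ne_top {p : ℝ≥0∞} (h : p ≠ 0) : infoContent p ≠ ⊤ := by
  simpa [infoContent, EReal.toENNReal_eq_top_iff, EReal.neg_eq_top_iff] using h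

lemma infoContent_mul {p q : ℝ≥0∞} (hp : p ≤ 1) (hq : q ≤ 1) :
    infoContent (p * q) = infoContent p + infoContent q := by
  have hp' : 0 ≤ -ENNReal.log p := by simpa using hp
  have hq' : 0 ≤ -ENNReal.log q := by simpa using hq
  have hp_top : ENNReal.log p ≠ ⊤ := by simpa using (hp.trans_lt ENNReal.one_lt_top).ne
  have hq_top : ENNReal.log q ≠ ⊤ := by simpa using (hq.trans_lt ENNReal.one_lt_top).ne
  rw [infoContent, ENNReal.log_mul_add, EReal.neg_add (.inr hq_top) (.inl hp_top),
    sub_eq_add_neg, EReal.toENNReal_add hp' hq', infoContent, infoContent]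

lemma infoContent_prod {ι : Type*} (s : Finset ι) {p : ι → ℝ≥0∞} (hp : ∀ i ∈ s, p i ≤ 1) :
    infoContent (∏ i ∈ s, p i) = ∑ i ∈ s, infoContent (p i) := by
  classical
  induction s using Finset.induction_on with
  | empty => simp
  | insert i s hi ih =>
    have hs : ∀ j ∈ s, p j ≤ 1 := fun j hj => hp j (Finset.mem_insert_of_mem hj)
    rw [Finset.prod_insert hi, Finset.sum_insert hi,
      infoContent_mul (hp i (Finset.mem_insert_self i s)) (Finset.prod_le_one' hs), ih hs]

lemma mul_infoContent_self {p : ℝ≥0∞} (h : p ≤ 1) :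
    p * infoContent p = ENNReal.ofReal (Real.negMulLog p.toReal) := by
  have htop : p ≠ ⊤ := (h.trans_lt ENNReal.one_lt_top).ne
  rcases eq_or_ne p 0 with rfl | h0
  · simp
  rw [infoContent_of_ne h0 htop]
  nth_rw 1 [← ENNReal.ofReal_toReal htop]
  rw [← ENNReal.ofReal_mul ENNReal.toReal_nonneg, Real.negMulLog, neg_mul, mul_neg]

lemma mul_infoContent_self_add_le {p : ℝ≥0∞} (hp : p ≤ 1) (q : ℝ≥0∞) :
    p * infoContent p + p ≤ p * infoContent q + q := by
  have hp_top : p ≠ ⊤ := (hp.trans_lt ENNReal.one_lt_top).ne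
  rcases eq_or_ne p 0 with rfl | hp0
  · simp
  rcases eq_or_ne q 0 with rfl | hq0
  · simp [ENNReal.mul_top hp0]
  rcases eq_or_ne q ⊤ with rfl | hq_top
  · simp
  have ha : 0 < p.toReal := ENNReal.toReal_pos hp0 hp_top
  have hb : 0 < q.toReal := ENNReal.toReal_pos hq0 hq_top
  have hreal : Real.negMulLog p.toReal + p.toReal ≤
      p.toReal * -Real.log q.toReal + q.toReal := by
    have h := mul_le_mul_of_nonneg_left (Real.log_le_sub_one_of_pos (div_pos hb ha)) ha.le
    rw [Real.log_div hb.ne' ha.ne', mul_sub, mul_sub, mul_one, mul_div_cancel₀ _ ha.ne'] at h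
    rw [Real.negMulLog]
    linarith
  calc p * infoContent p + p
      = ENNReal.ofReal (Real.negMulLog p.toReal + p.toReal) := by
        rw [mul_infoContent_self hp, ENNReal.ofReal_add (Real.negMulLog_nonneg ha.le
          (ENNReal.toReal_le_of_le_ofReal zero_le_one (by simpa using hp))) ha.le,
          ENNReal.ofReal_toReal hp_top]
    _ ≤ ENNReal.ofReal (p.toReal * -Real.log q.toReal + q.toReal) :=
        ENNReal.ofReal_le_ofReal hreal
    _ ≤ ENNReal.ofReal (p.toReal * -Real.log q.toReal) + ENNReal.ofReal q.toReal :=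
        ENNReal.ofReal_add_le
    _ = p * infoContent q + q := by
        rw [ENNReal.ofReal_mul ha.le, ENNReal.ofReal_toReal hp_top, ENNReal.ofReal_toReal hq_top,
          infoContent_of_ne hq0 hq_top]

/-- The Shannon entropy of a random variable `X`, namely the mean information content of its value.
No countability is required: a value of probability zero has information content `∞`. -/
noncomputable def entropy {Ω A : Type*} [MeasurableSpace Ω] (μ : Measure Ω) (X : Ω → A) : ℝ≥0∞ :=
  ∫⁻ ω, infoContent (μ (X ⁻¹' {X ω})) ∂μ

lemma entropy_comp_le {Ω A B : Type*} [MeasurableSpace Ω] (μ : Measure Ω) (X : Ω → A)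
    (f : A → B) : entropy μ (f ∘ X) ≤ entropy μ X :=
  lintegral_mono fun ω => infoContent_antitone <| measure_mono fun ω' (h : X ω' = X ω) =>
    congrArg f h

lemma baseEntropy_eq_entropy_id {K : Type*} [MeasurableSpace K] [MeasurableSingletonClass K]
    (κ : Measure K) [IsProbabilityMeasure κ] : baseEntropy κ = entropy κ id := by
  change baseEntropy κ = ∫⁻ x, infoContent (κ {x}) ∂κ
  unfold baseEntropy
  split_ifs with h
  · obtain ⟨K', hK', hone⟩ := h
    have hnull : κ K'ᶜ = 0 := (prob_compl_eq_zero_iff hK'.measurableSet).2 hone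
    rw [← lintegral_add_compl _ hK'.measurableSet, setLIntegral_measure_zero _ _ hnull, add_zero,
      lintegral_countable _ hK', ← tsum_subtype_eq_of_support_subset (s := K')]
    · exact tsum_congr fun k => by
        rw [mul_comm, mul_infoContent_self prob_le_one, measureReal_def]
    · intro k hk
      by_contra hk'
      have : κ {k} = 0 := measure_mono_null (Set.singleton_subset_iff.2 hk') hnull
      exact hk (by simp [measureReal_def, this])
  · set atoms : Set K := {x | 0 < κ {x}}
    have hatoms : atoms.Countable :=
      Measure.countable_meas_pos_of_disjoint_iUnion (As := fun x : K => {x})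
        measurableSet_singleton fun x y hxy => by simpa using hxy
    have hpos : κ atomsᶜ ≠ 0 := fun hz =>
      h ⟨atoms, hatoms, (prob_compl_eq_zero_iff hatoms.measurableSet).1 hz⟩
    refine (eq_top_iff.2 ?_).symm
    calc (⊤ : ℝ≥0∞) = ∫⁻ _ in atomsᶜ, ⊤ ∂κ := by simp [hpos, ENNReal.top_mul]
      _ ≤ ∫⁻ x in atomsᶜ, infoContent (κ {x}) ∂κ := by
          refine setLIntegral_mono' hatoms.measurableSet.compl fun x hx => ?_
          have : κ {x} = 0 := by simpa [atoms] using hx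
          simp [this]
      _ ≤ _ := setLIntegral_le_lintegral _ _

lemma baseEntropy_map_measurableEquiv {K L : Type*} [MeasurableSpace K] [MeasurableSpace L]
    [MeasurableSingletonClass K] [MeasurableSingletonClass L] (κ : Measure K)
    [IsProbabilityMeasure κ] (e : K ≃ᵐ L) : baseEntropy (κ.map e) = baseEntropy κ := by
  have := Measure.isProbabilityMeasure_map (μ := κ) e.measurable.aemeasurable
  rw [baseEntropy_eq_entropy_id, baseEntropy_eq_entropy_id, entropy, entropy, lintegral_map_equiv]
  refine lintegral_congr fun x => ?_
  rw [e.map_apply]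
  congr 2
  ext y
  simp

lemma entropy_le_baseEntropy {K A : Type*} [MeasurableSpace K] [MeasurableSingletonClass K]
    (κ : Measure K) [IsProbabilityMeasure κ] (X : K → A) : entropy κ X ≤ baseEntropy κ :=
  (entropy_comp_le κ id X).trans_eq (baseEntropy_eq_entropy_id κ).symm

lemma entropy_comp_measurePreserving {Ω Ω' A : Type*} [MeasurableSpace Ω] [MeasurableSpace Ω']
    [MeasurableSpace A] [MeasurableSingletonClass A] [Countable A] {μ : Measure Ω}
    {ν : Measure Ω'} {φ : Ω → Ω'} (hφ : MeasurePreserving φ μ ν) {X : Ω' → A}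
    (hX : Measurable X) : entropy μ (X ∘ φ) = entropy ν X := by
  have hmeas : Measurable fun ω => infoContent (ν (X ⁻¹' {X ω})) :=
    (measurable_of_countable fun a => infoContent (ν (X ⁻¹' {a}))).comp hX
  rw [entropy, entropy, ← hφ.lintegral_comp hmeas]
  refine lintegral_congr fun ω => ?_
  rw [Set.preimage_comp,
    hφ.measure_preimage (hX (measurableSet_singleton _)).nullMeasurableSet, Function.comp_apply]

lemma lintegral_comp_fintype {Ω A : Type*} [MeasurableSpace Ω] [MeasurableSpace A]
    [MeasurableSingletonClass A] [Fintype A] (μ : Measure Ω) {X : Ω → A} (hX : Measurable X)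
    (f : A → ℝ≥0∞) : ∫⁻ ω, f (X ω) ∂μ = ∑ a, μ (X ⁻¹' {a}) * f a := by
  rw [← lintegral_map (measurable_of_finite f) hX, lintegral_fintype]
  exact Finset.sum_congr rfl fun a _ => by
    rw [Measure.map_apply hX (measurableSet_singleton a), mul_comm]

lemma sum_measure_preimage_singleton_eq_one {Ω A : Type*} [MeasurableSpace Ω] [MeasurableSpace A]
    [MeasurableSingletonClass A] [Fintype A] (μ : Measure Ω) [IsProbabilityMeasure μ] {X : Ω → A}
    (hX : Measurable X) : ∑ a, μ (X ⁻¹' {a}) = 1 := by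
  simpa using (lintegral_comp_fintype μ hX fun _ => 1).symm

lemma entropy_le_lintegral_infoContent {Ω A : Type*} [MeasurableSpace Ω] [MeasurableSpace A]
    [MeasurableSingletonClass A] [Fintype A] (μ : Measure Ω) [IsProbabilityMeasure μ] {X : Ω → A}
    (hX : Measurable X) {p : A → ℝ≥0∞} (hp : ∑ a, p a ≤ 1) :
    entropy μ X ≤ ∫⁻ ω, infoContent (p (X ω)) ∂μ := by
  have hsum : entropy μ X + 1 ≤ (∫⁻ ω, infoContent (p (X ω)) ∂μ) + 1 := calc
    entropy μ X + 1
      = ∑ a, (μ (X ⁻¹' {a}) * infoContent (μ (X ⁻¹' {a})) + μ (X ⁻¹' {a})) := by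
        rw [Finset.sum_add_distrib, sum_measure_preimage_singleton_eq_one μ hX, entropy,
          lintegral_comp_fintype μ hX fun a => infoContent (μ (X ⁻¹' {a}))]
    _ ≤ ∑ a, (μ (X ⁻¹' {a}) * infoContent (p a) + p a) :=
        Finset.sum_le_sum fun a _ => mul_infoContent_self_add_le prob_le_one (p a)
    _ ≤ (∫⁻ ω, infoContent (p (X ω)) ∂μ) + 1 := by
        rw [Finset.sum_add_distrib, lintegral_comp_fintype μ hX fun a => infoContent (p a)]
        gcongr
  exact (ENNReal.add_le_add_iff_right ENNReal.one_ne_top).1 hsum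

lemma entropy_infinitePi {V K A : Type*} [Fintype V] [MeasurableSpace K] [MeasurableSpace A]
    [MeasurableSingletonClass A] [Countable A] (κ : Measure K) [IsProbabilityMeasure κ]
    {q : K → A} (hq : Measurable q) :
    entropy (Measure.infinitePi fun _ : V => κ) (fun x v => q (x v)) =
      Fintype.card V * entropy κ q := by
  have hlevel (x : V → K) : (Measure.infinitePi fun _ : V => κ)
      ((fun (x : V → K) v => q (x v)) ⁻¹' {fun v => q (x v)}) = ∏ v, κ (q ⁻¹' {q (x v)}) := by
    have hpi : (fun (x : V → K) v => q (x v)) ⁻¹' {fun v => q (x v)} =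
        Set.pi (Finset.univ : Finset V) fun v => q ⁻¹' {q (x v)} := by
      ext y
      simp [funext_iff]
    rw [hpi, Measure.infinitePi_pi _ fun v _ => hq (measurableSet_singleton _)]
  let info : K → ℝ≥0∞ := fun k => infoContent (κ (q ⁻¹' {q k}))
  have hinfo : Measurable info :=
    (measurable_of_countable fun a => infoContent (κ (q ⁻¹' {a}))).comp hq
  calc entropy (Measure.infinitePi fun _ : V => κ) (fun x v => q (x v))
      = ∫⁻ x, ∑ v, info (x v) ∂Measure.infinitePi fun _ : V => κ :=
        lintegral_congr fun x => by rw [hlevel, infoContent_prod _ fun v _ => prob_le_one]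
    _ = ∑ _v : V, entropy κ q := by
        rw [lintegral_finsetSum _ fun v _ => by fun_prop]
        exact Finset.sum_congr rfl fun v _ =>
          (measurePreserving_eval_infinitePi (fun _ : V => κ) v).lintegral_comp hinfo
    _ = Fintype.card V * entropy κ q := by simp

/-- The first `n` bits of the image of a point under an embedding of a countably generated space
into the Cantor space; they define an increasing sequence of finite partitions. -/
noncomputable def bits (K : Type*) [MeasurableSpace K] [MeasurableSpace.CountablyGenerated K]
    (n : ℕ) (x : K) (i : Fin n) : Bool := MeasurableSpace.mapNatBool K x i

lemma measurable_bits (K : Type*) [MeasurableSpace K] [MeasurableSpace.CountablyGenerated K]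
    (n : ℕ) : Measurable (bits K n) :=
  measurable_pi_lambda _ fun i =>
    (measurable_pi_apply (i : ℕ)).comp (MeasurableSpace.measurable_mapNatBool K)

section Bits

variable {K : Type*} [MeasurableSpace K] [MeasurableSpace.CountablyGenerated K]

lemma antitone_bits_fiber (x : K) : Antitone fun n => bits K n ⁻¹' {bits K n x} :=
  fun _ _ hnm _ hy => funext fun i => congrFun hy (Fin.castLE hnm i)

lemma iInter_bits_fiber [MeasurableSingletonClass K] (x : K) :
    ⋂ n, bits K n ⁻¹' {bits K n x} = {x} := by
  refine subset_antisymm (fun y hy => ?_) (by simp)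
  refine MeasurableSpace.injective_mapNatBool K (funext fun i => ?_)
  exact congrFun (Set.mem_iInter.1 hy (i + 1)) ⟨i, Nat.lt_succ_self i⟩

lemma baseEntropy_eq_iSup_entropy_bits [MeasurableSingletonClass K] (κ : Measure K)
    [IsProbabilityMeasure κ] : baseEntropy κ = ⨆ n, entropy κ (bits K n) := by
  have hmono (x : K) : Monotone fun n => infoContent (κ (bits K n ⁻¹' {bits K n x})) :=
    fun _ _ hnm => infoContent_antitone (measure_mono (antitone_bits_fiber x hnm))
  have hlim (x : K) : Tendsto (fun n => infoContent (κ (bits K n ⁻¹' {bits K n x}))) atTop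
      (𝓝 (infoContent (κ {x}))) := by
    rw [← iInter_bits_fiber x]
    exact (continuous_infoContent.tendsto _).comp <| tendsto_measure_iInter_atTop
      (fun n => (measurable_bits K n (measurableSet_singleton _)).nullMeasurableSet)
      (antitone_bits_fiber x) ⟨0, measure_ne_top _ _⟩
  have hmeas (n : ℕ) : Measurable fun x => infoContent (κ (bits K n ⁻¹' {bits K n x})) :=
    (measurable_of_finite fun a => infoContent (κ (bits K n ⁻¹' {a}))).comp (measurable_bits K n)
  calc baseEntropy κ
      = ∫⁻ x, ⨆ n, infoContent (κ (bits K n ⁻¹' {bits K n x})) ∂κ := by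
        rw [baseEntropy_eq_entropy_id]
        exact lintegral_congr fun x => (iSup_eq_of_tendsto (hmono x) (hlim x)).symm
    _ = ⨆ n, entropy κ (bits K n) := lintegral_iSup hmeas fun _ _ h x => hmono x h

end Bits

/-! ### Memoryless codes with correction -/

/-- The length, in nats, of a two-part description of a symbol `a`: a label `b` encoded with the
code weights `w`, followed by `a` encoded with the code weights `W c` that correspond to the
prediction `c` of `a` made from the labels. -/
noncomputable def descriptionLength {A B C : Type*} (w : B → ℝ≥0∞) (W : C → A → ℝ≥0∞) (b : B)
    (c : C) (a : A) : ℝ≥0∞ :=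
  infoContent (w b) + infoContent (W c a)

section Coding

variable {A B C : Type*} {w : B → ℝ≥0∞} {W : C → A → ℝ≥0∞}

lemma exists_descriptionLength_le [Finite A] [Finite B] [Finite C] (hw : ∀ b, w b ≠ 0)
    (hW : ∀ c a, W c a ≠ 0) : ∃ M ≠ ⊤, ∀ b c a, descriptionLength w W b c a ≤ M := by
  have := Fintype.ofFinite (B × C × A)
  refine ⟨∑ i : B × C × A, descriptionLength w W i.1 i.2.1 i.2.2, ?_, fun b c a => ?_⟩
  · exact ENNReal.sum_ne_top.2 fun i _ =>
      ENNReal.add_ne_top.2 ⟨infoContent_ne_top (hw _), infoContent_ne_top (hW _ _)⟩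
  · exact Finset.single_le_sum (f := fun i : B × C × A => descriptionLength w W i.1 i.2.1 i.2.2)
      (by simp) (Finset.mem_univ (b, c, a))

variable [Fintype A] [Fintype B]

lemma sum_prod_mul_prod_le_one {V : Type*} [Fintype V] [DecidableEq V] (hw : ∑ b, w b ≤ 1)
    (hW : ∀ c, ∑ a, W c a ≤ 1) (D : V → (V → B) → C) :
    ∑ z : (V → A) × (V → B), (∏ v, w (z.2 v)) * ∏ v, W (D v z.2) (z.1 v) ≤ 1 := by
  calc ∑ z : (V → A) × (V → B), (∏ v, w (z.2 v)) * ∏ v, W (D v z.2) (z.1 v)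
      = ∑ y : V → B, (∏ v, w (y v)) * ∏ v, ∑ a, W (D v y) a := by
        rw [Fintype.sum_prod_type_right]
        simp only [← Finset.mul_sum, Fintype.prod_sum]
    _ ≤ ∑ y : V → B, (∏ v, w (y v)) * 1 := by
        gcongr with y
        exact Finset.prod_le_one' fun v _ => hW (D v y)
    _ = (∑ b, w b) ^ Fintype.card V := by
        simp only [mul_one, ← Fintype.prod_sum, Finset.prod_const, Finset.card_univ]
    _ ≤ 1 := pow_le_one' hw _

/-- The symbols can be read off their description, whose length is `-log` of a subprobability
weight on the pairs of a sequence of symbols and a sequence of labels: this is Gibbs' inequality. -/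
lemma entropy_le_sum_lintegral_descriptionLength {Ω V : Type*} [MeasurableSpace Ω] [Fintype V]
    [MeasurableSpace A] [MeasurableSingletonClass A] [MeasurableSpace B]
    [MeasurableSingletonClass B] (μ : Measure Ω) [IsProbabilityMeasure μ] {X : Ω → V → A}
    (hX : Measurable X) {Y : Ω → V → B} (hY : Measurable Y) (D : V → (V → B) → C)
    (hw : ∑ b, w b ≤ 1) (hW : ∀ c, ∑ a, W c a ≤ 1) :
    entropy μ X ≤ ∑ v, ∫⁻ ω, descriptionLength w W (Y ω v) (D v (Y ω)) (X ω v) ∂μ := by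
  classical
  have hw_one (b : B) : w b ≤ 1 := (Finset.single_le_sum (by simp) (Finset.mem_univ b)).trans hw
  have hW_one (c : C) (a : A) : W c a ≤ 1 :=
    (Finset.single_le_sum (by simp) (Finset.mem_univ a)).trans (hW c)
  calc entropy μ X ≤ entropy μ fun ω => (X ω, Y ω) :=
        entropy_comp_le μ (fun ω => (X ω, Y ω)) Prod.fst
    _ ≤ ∫⁻ ω, infoContent ((∏ v, w (Y ω v)) * ∏ v, W (D v (Y ω)) (X ω v)) ∂μ :=
        entropy_le_lintegral_infoContent μ (hX.prodMk hY) (sum_prod_mul_prod_le_one hw hW D)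
    _ = ∫⁻ ω, ∑ v, descriptionLength w W (Y ω v) (D v (Y ω)) (X ω v) ∂μ := by
        refine lintegral_congr fun ω => ?_
        rw [infoContent_mul (Finset.prod_le_one' fun v _ => hw_one _)
          (Finset.prod_le_one' fun v _ => hW_one _ _), infoContent_prod _ fun v _ => hw_one _,
          infoContent_prod _ fun v _ => hW_one _ _, ← Finset.sum_add_distrib]
        rfl
    _ = ∑ v, ∫⁻ ω, descriptionLength w W (Y ω v) (D v (Y ω)) (X ω v) ∂μ :=
        lintegral_finsetSum _ fun v _ => (measurable_of_finite
          fun z : (V → A) × (V → B) => descriptionLength w W (z.2 v) (D v z.2) (z.1 v)).comp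
            (hX.prodMk hY)

end Coding

/-! ### Coding on a sofic model -/

lemma le_of_forall_le_add_mul {a b c : ℝ≥0∞} (hc : c ≠ ⊤) (h : ∀ ε ≠ 0, a ≤ b + c * ε) :
    a ≤ b := by
  have hlim : Tendsto (fun ε => b + c * ε) (𝓝[>] 0) (𝓝 b) := by
    have h : Tendsto (fun ε => b + c * ε) (𝓝 0) (𝓝 (b + c * 0)) :=
      (ENNReal.Tendsto.const_mul tendsto_id (.inr hc)).const_add b
    rw [mul_zero, add_zero] at h
    exact h.mono_left nhdsWithin_le_nhds
  refine ge_of_tendsto hlim ?_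
  filter_upwards [self_mem_nhdsWithin] with ε hε using h ε hε.ne'

section Reindexing

variable {ι ι' K : Type*} [MeasurableSpace K] (κ : Measure K) [IsProbabilityMeasure κ] {j : ι → ι'}

lemma measurePreserving_comp_injective (hj : j.Injective) :
    MeasurePreserving (fun (x : ι' → K) => x ∘ j) (Measure.infinitePi fun _ => κ)
      (Measure.infinitePi fun _ => κ) :=
  ⟨by fun_prop, Measure.map_infinitePi_infinitePi_of_inj (P := fun _ => κ) hj⟩

lemma lintegral_comp_of_dependsOn {S : Set ι} (hj : S.InjOn j) {Ψ : (ι → K) → ℝ≥0∞}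
    (hΨ : Measurable Ψ) (hΨS : DependsOn Ψ S) :
    ∫⁻ x, Ψ (x ∘ j) ∂(Measure.infinitePi fun _ => κ) =
      ∫⁻ x, Ψ x ∂(Measure.infinitePi fun _ => κ) := by
  classical
  obtain ⟨k₀⟩ := nonempty_of_isProbabilityMeasure κ
  let extend (r : S → K) (i : ι) : K := if hi : i ∈ S then r ⟨i, hi⟩ else k₀
  have hextend : Measurable extend := measurable_pi_lambda _ fun i => by
    by_cases hi : i ∈ S <;> simp only [extend, hi, dif_pos, dif_neg, not_false_eq_true] <;> fun_prop
  have hΨ_extend (x : ι → K) : Ψ (extend (x ∘ Subtype.val)) = Ψ x :=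
    hΨS fun i hi => by simp [extend, hi]
  calc ∫⁻ x, Ψ (x ∘ j) ∂(Measure.infinitePi fun _ => κ)
      = ∫⁻ x : ι' → K, Ψ (extend (x ∘ fun i : S => j i)) ∂(Measure.infinitePi fun _ => κ) :=
        lintegral_congr fun x => (hΨ_extend (x ∘ j)).symm
    _ = ∫⁻ r, Ψ (extend r) ∂(Measure.infinitePi fun _ => κ) :=
        (measurePreserving_comp_injective κ hj.injective).lintegral_comp (hΨ.comp hextend)
    _ = ∫⁻ x : ι → K, Ψ (extend (x ∘ Subtype.val)) ∂(Measure.infinitePi fun _ => κ) :=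
        ((measurePreserving_comp_injective κ Subtype.val_injective).lintegral_comp
          (hΨ.comp hextend)).symm
    _ = ∫⁻ x, Ψ x ∂(Measure.infinitePi fun _ => κ) := lintegral_congr hΨ_extend

end Reindexing

lemma sum_indicator_const {V : Type*} [Fintype V] (s : Set V) (c : ℝ≥0∞) :
    ∑ v, s.indicator (fun _ => c) v = s.ncard * c := by
  classical
  rw [Finset.sum_indicator_eq_sum_filter, Finset.sum_const, nsmul_eq_mul,
    Set.ncard_eq_toFinset_card']
  congr 3
  ext v
  simp

section Sofic

variable {G : Type*} [Group G]

lemma goodPoints_anti {m : ℕ} (σ : G → Equiv.Perm (Fin m)) : Antitone (goodPoints σ) :=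
  fun _ _ h _ hv => ⟨fun a ha b hb => hv.1 a (h ha) b (h hb),
    fun a ha b hb => hv.2 a (h ha) b (h hb)⟩

lemma IsApproximation.ncard_compl_goodPoints_le {m : ℕ} {σ : G → Equiv.Perm (Fin m)} {F : Set G}
    {ε : ℝ} (h : IsApproximation σ F ε) :
    ((goodPoints σ F)ᶜ.ncard : ℝ≥0∞) ≤ ENNReal.ofReal ε * m := by
  have hcard : ((goodPoints σ F).ncard : ℝ) + (goodPoints σ F)ᶜ.ncard = m := by
    exact_mod_cast (Set.ncard_add_ncard_compl (goodPoints σ F)).trans (Nat.card_fin m)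
  have hreal : ((goodPoints σ F)ᶜ.ncard : ℝ) ≤ ε * m := by
    unfold IsApproximation at h
    linarith
  rw [← ENNReal.ofReal_natCast, ← ENNReal.ofReal_natCast m, ← ENNReal.ofReal_mul' m.cast_nonneg]
  exact ENNReal.ofReal_le_ofReal hreal

lemma IsSofic.exists_ncard_compl_goodPoints_le (hG : IsSofic G) (S : Finset G) {ε : ℝ≥0∞}
    (hε : ε ≠ 0) :
    ∃ m : ℕ, m ≠ 0 ∧ ∃ σ : G → Equiv.Perm (Fin m), ((goodPoints σ S)ᶜ.ncard : ℝ≥0∞) ≤ ε * m := by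
  obtain ⟨m, σ, hm, F, δ, hF, hF_univ, hδ, happrox⟩ := hG
  have hS : ∀ᶠ i in atTop, ∀ g ∈ S, g ∈ F i := by
    rw [eventually_all_finset]
    intro g _
    obtain ⟨i, hi⟩ := Set.mem_iUnion.1 (hF_univ.symm ▸ Set.mem_univ g)
    filter_upwards [eventually_ge_atTop i] with k hk using monotone_nat_of_le_succ hF hk hi
  have hδε : ∀ᶠ i in atTop, ENNReal.ofReal (δ i) < ε :=
    (ENNReal.tendsto_ofReal hδ).eventually_lt_const (by simpa using pos_iff_ne_zero.2 hε)
  obtain ⟨i, hSi, hδi⟩ := (hS.and hδε).exists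
  refine ⟨m i, Nat.one_le_iff_ne_zero.1 (hm i), σ i, ?_⟩
  calc ((goodPoints (σ i) S)ᶜ.ncard : ℝ≥0∞) ≤ (goodPoints (σ i) (F i))ᶜ.ncard := by
        exact_mod_cast Set.ncard_le_ncard (Set.compl_subset_compl.2 (goodPoints_anti _ hSi))
    _ ≤ ENNReal.ofReal (δ i) * m i := (happrox i).ncard_compl_goodPoints_le
    _ ≤ ε * m i := by gcongr

/-- The map `h ↦ σ(h⁻¹) v` through which a configuration `x` on the sofic model `{1, …, m}` is seen
from the point `v` as the configuration `x ∘ modelOrbit σ v` on `G`. The inverse makes left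
translations of `G` correspond to moving `v`, see `modelOrbit_modelOrbit`. -/
def modelOrbit {m : ℕ} (σ : G → Equiv.Perm (Fin m)) (v : Fin m) (h : G) : Fin m := σ h⁻¹ v

section ModelOrbit

variable {m : ℕ} {σ : G → Equiv.Perm (Fin m)} {T : Set G} {v : Fin m}

lemma injOn_modelOrbit (hv : v ∈ goodPoints σ T⁻¹) : T.InjOn (modelOrbit σ v) :=
  fun a ha b hb hab => by_contra fun hne => hv.2 a⁻¹ (Set.inv_mem_inv.2 ha) b⁻¹
    (Set.inv_mem_inv.2 hb) (inv_injective.ne hne) hab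

lemma modelOrbit_one (hv : v ∈ goodPoints σ T⁻¹) (hT : 1 ∈ T) : modelOrbit σ v 1 = v := by
  have h := hv.1 1 (by simpa using hT) 1 (by simpa using hT)
  rw [mul_one] at h
  rw [modelOrbit, inv_one]
  exact (σ 1).injective h

lemma modelOrbit_modelOrbit (hv : v ∈ goodPoints σ T⁻¹) {s h : G} (hs : s ∈ T) (hh : h ∈ T) :
    modelOrbit σ (modelOrbit σ v s) h = modelOrbit σ v (s * h) := by
  rw [modelOrbit, modelOrbit, hv.1 _ (Set.inv_mem_inv.2 hh) _ (Set.inv_mem_inv.2 hs), modelOrbit,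
    mul_inv_rev]

end ModelOrbit

/-- The shift-equivariant map `K^G → B^G` generated by the observable `β`. -/
def slidingBlock {K B : Type*} (β : (G → K) → B) (x : G → K) (s : G) : B :=
  β fun h => x (s * h)

section SlidingBlock

variable {K B A : Type*} {β : (G → K) → B} {g : (G → B) → A} {E F : Set G}

lemma slidingBlock_one (β : (G → K) → B) (x : G → K) : slidingBlock β x 1 = β x := by
  simp only [slidingBlock, one_mul]

lemma measurable_slidingBlock [MeasurableSpace K] [MeasurableSpace B] (hβ : Measurable β) :
    Measurable (slidingBlock β) :=
  measurable_pi_lambda _ fun _ => hβ.comp (by fun_prop)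

lemma dependsOn_comp_slidingBlock (hβ : DependsOn β F) (hg : DependsOn g E) :
    DependsOn (fun x => g (slidingBlock β x)) (E * F) :=
  fun _ _ hxy => hg fun _ hs => hβ fun _ hh => hxy _ (Set.mul_mem_mul hs hh)

end SlidingBlock

section Transfer

variable {K A B : Type*} [MeasurableSpace K] (κ : Measure K) [IsProbabilityMeasure κ]
  [MeasurableSpace A] [MeasurableSingletonClass A] [MeasurableSpace B] [MeasurableSingletonClass B]
  {β : (G → K) → B} {g : (G → B) → A} {q : K → A}

lemma lintegral_model_eq [Finite A] [Finite B] {m : ℕ} {σ : G → Equiv.Perm (Fin m)} {v : Fin m}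
    {E F : Set G} (hv : v ∈ goodPoints σ (insert 1 E * insert 1 F)⁻¹) (hβ : Measurable β)
    (hβF : DependsOn β F) (hg : Measurable g) (hgE : DependsOn g E) (hq : Measurable q)
    (ℓ : B → A → A → ℝ≥0∞) :
    ∫⁻ x, ℓ (β (x ∘ modelOrbit σ v)) (g fun s => β (x ∘ modelOrbit σ (modelOrbit σ v s)))
        (q (x v)) ∂(Measure.infinitePi fun _ : Fin m => κ) =
      ∫⁻ x, ℓ (β x) (g (slidingBlock β x)) (q (x 1)) ∂(Measure.infinitePi fun _ : G => κ) := by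
  set T : Set G := insert 1 E * insert 1 F
  have hE : insert 1 E ⊆ T := Set.subset_mul_left _ (Set.mem_insert 1 F)
  have hF : insert 1 F ⊆ T := Set.subset_mul_right _ (Set.mem_insert 1 E)
  have h1 : (1 : G) ∈ T := hE (Set.mem_insert 1 E)
  have hEF : E * F ⊆ T := Set.mul_subset_mul (Set.subset_insert 1 E) (Set.subset_insert 1 F)
  have hmeas : Measurable fun x : G → K => ℓ (β x) (g (slidingBlock β x)) (q (x 1)) :=
    (measurable_of_finite fun z : B × A × A => ℓ z.1 z.2.1 z.2.2).comp <|
      hβ.prodMk ((hg.comp (measurable_slidingBlock hβ)).prodMk (hq.comp (measurable_pi_apply 1)))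
  rw [← lintegral_comp_of_dependsOn κ (injOn_modelOrbit hv) hmeas fun x y hxy => ?_]
  · refine lintegral_congr fun x => ?_
    congr 1
    · exact hgE fun s hs => hβF fun h hh => congrArg x <|
        modelOrbit_modelOrbit hv (hE (.inr hs)) (hF (.inr hh))
    · rw [Function.comp_apply, modelOrbit_one hv h1]
  · have hblock : g (slidingBlock β x) = g (slidingBlock β y) :=
      dependsOn_comp_slidingBlock hβF hgE fun h hh => hxy h (hEF hh)
    rw [hβF fun h hh => hxy h (hF (.inr hh)), hblock, hxy 1 h1]

variable [Fintype A] [Fintype B] {w : B → ℝ≥0∞} {W : A → A → ℝ≥0∞}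

lemma IsSofic.entropy_le_lintegral_of_dependsOn (hG : IsSofic G) {E F : Finset G}
    (hβ : Measurable β) (hβF : DependsOn β F) (hg : Measurable g) (hgE : DependsOn g E)
    (hq : Measurable q) (hw : ∀ b, w b ≠ 0) (hw_sum : ∑ b, w b ≤ 1) (hW : ∀ c a, W c a ≠ 0)
    (hW_sum : ∀ c, ∑ a, W c a ≤ 1) :
    entropy κ q ≤ ∫⁻ x, descriptionLength w W (β x) (g (slidingBlock β x)) (q (x 1))
      ∂(Measure.infinitePi fun _ : G => κ) := by
  classical
  set I := ∫⁻ x, descriptionLength w W (β x) (g (slidingBlock β x)) (q (x 1))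
    ∂(Measure.infinitePi fun _ : G => κ)
  obtain ⟨M, hM, hM_le⟩ := exists_descriptionLength_le hw hW
  refine le_of_forall_le_add_mul hM fun ε hε => ?_
  obtain ⟨m, hm, σ, hσ⟩ :=
    hG.exists_ncard_compl_goodPoints_le (insert 1 E * insert 1 F)⁻¹ hε
  push_cast at hσ
  set good := goodPoints σ (insert 1 (E : Set G) * insert 1 (F : Set G))⁻¹
  let cost (v : Fin m) : ℝ≥0∞ := ∫⁻ x, descriptionLength w W (β (x ∘ modelOrbit σ v))
    (g fun s => β (x ∘ modelOrbit σ (modelOrbit σ v s))) (q (x v))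
      ∂(Measure.infinitePi fun _ : Fin m => κ)
  have hcost (v : Fin m) : cost v ≤ I + goodᶜ.indicator (fun _ => M) v := by
    by_cases hv : v ∈ good
    · simpa [hv] using (lintegral_model_eq κ hv hβ hβF hg hgE hq _).le
    · simpa [hv] using (lintegral_mono fun x => hM_le _ _ _).trans (by simp)
  have hmodel : m * entropy κ q ≤ m * (I + M * ε) := calc
    m * entropy κ q
      = entropy (Measure.infinitePi fun _ : Fin m => κ) fun x v => q (x v) := by
        rw [entropy_infinitePi κ hq, Fintype.card_fin]
    _ ≤ ∑ v, cost v := entropy_le_sum_lintegral_descriptionLength _ (by fun_prop)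
        (Y := fun x v => β (x ∘ modelOrbit σ v))
        (measurable_pi_lambda _ fun v => hβ.comp (by fun_prop))
        (fun v y => g fun s => y (modelOrbit σ v s)) hw_sum hW_sum
    _ ≤ ∑ v, (I + goodᶜ.indicator (fun _ => M) v) := Finset.sum_le_sum fun v _ => hcost v
    _ = m * I + goodᶜ.ncard * M := by
        rw [Finset.sum_add_distrib, sum_indicator_const, Finset.sum_const, Finset.card_univ,
          Fintype.card_fin, nsmul_eq_mul]
    _ ≤ m * I + ε * m * M := by gcongr
    _ = m * (I + M * ε) := by ring
  exact (ENNReal.mul_le_mul_iff_right (by exact_mod_cast hm) (ENNReal.natCast_ne_top m)).1 hmodel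

end Transfer

end Sofic

/-! ### Finitary approximation of factor maps -/

section Approximation

variable {ι A : Type*} [Finite A] [Nonempty A] [MeasurableSpace A] [MeasurableSingletonClass A]

lemma exists_measurableCylinder_symmDiff_lt {X : ι → Type*} [∀ i, MeasurableSpace (X i)]
    (μ : Measure (∀ i, X i)) [IsFiniteMeasure μ] {s : Set (∀ i, X i)} (hs : MeasurableSet s)
    {ε : ℝ≥0∞} (hε : ε ≠ 0) : ∃ t ∈ measurableCylinders X, μ (symmDiff t s) < ε :=
  exists_measure_symmDiff_lt_of_generateFrom_isSetRing isSetRing_measurableCylinders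
    ⟨{Set.univ}, Set.countable_singleton _, by simpa using univ_mem_measurableCylinders X, by simp⟩
    generateFrom_measurableCylinders.symm hs hε.pos

lemma exists_dependsOn_measure_ne_le {X : ι → Type*} [∀ i, MeasurableSpace (X i)]
    (μ : Measure (∀ i, X i)) [IsFiniteMeasure μ] {h : (∀ i, X i) → A} (hh : Measurable h)
    {ε : ℝ≥0∞} (hε : ε ≠ 0) :
    ∃ (F : Finset ι) (f : (∀ i, X i) → A), Measurable f ∧ DependsOn f F ∧
      μ {x | h x ≠ f x} ≤ ε := by
  classical
  have := Fintype.ofFinite A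
  have hdiv : ε / Fintype.card A ≠ 0 := ENNReal.div_ne_zero.2 ⟨hε, ENNReal.natCast_ne_top _⟩
  choose T hT hTμ using fun a =>
    exists_measurableCylinder_symmDiff_lt μ (hh (measurableSet_singleton a)) hdiv
  choose s S _ hTS using fun a => (mem_measurableCylinders _).1 (hT a)
  -- Where no `T a` differs from `h ⁻¹' {a}`, the value `h x` is the only `a` with `x ∈ T a`.
  let f (x : ∀ i, X i) : A := Classical.epsilon fun a => x ∈ T a
  refine ⟨Finset.univ.biUnion s, f, ?_, fun x y hxy => ?_, ?_⟩
  · exact (measurable_of_finite fun P : A → Prop => Classical.epsilon P).comp <|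
      measurable_pi_lambda _ fun a =>
        measurable_mem.2 (MeasurableSet.of_mem_measurableCylinders (hT a))
  · have hmem (a : A) : x ∈ T a ↔ y ∈ T a := by
      rw [hTS a, mem_cylinder, mem_cylinder]
      have : (s a).restrict x = (s a).restrict y := funext fun i =>
        hxy i (Finset.mem_coe.2 (Finset.mem_biUnion.2 ⟨a, Finset.mem_univ a, i.2⟩))
      rw [this]
    simp only [f, hmem]
  have hsub : {x | h x ≠ f x} ⊆ ⋃ a, symmDiff (T a) (h ⁻¹' {a}) := fun x hx => by
    by_contra hx'
    have hmem : (fun a => x ∈ T a) = fun a => a = h x := by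
      funext a
      have hxa : x ∉ symmDiff (T a) (h ⁻¹' {a}) := fun h => hx' (Set.mem_iUnion.2 ⟨a, h⟩)
      rw [Set.mem_symmDiff, Set.mem_preimage, Set.mem_singleton_iff] at hxa
      exact propext ⟨fun hx => by tauto, fun hx => by tauto⟩
    exact hx (by simp only [f, hmem, Classical.epsilon_singleton])
  calc μ {x | h x ≠ f x} ≤ ∑ a, μ (symmDiff (T a) (h ⁻¹' {a})) :=
        (measure_mono hsub).trans (measure_iUnion_fintype_le _ _)
    _ ≤ ∑ _a : A, ε / Fintype.card A := Finset.sum_le_sum fun a _ => (hTμ a).le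
    _ = ε := by
        rw [Finset.sum_const, Finset.card_univ, nsmul_eq_mul]
        exact ENNReal.mul_div_cancel (by simp) (ENNReal.natCast_ne_top _)

lemma comap_mapNatBool (L : Type*) [mL : MeasurableSpace L] [MeasurableSpace.CountablyGenerated L] :
    MeasurableSpace.comap (MeasurableSpace.mapNatBool L) inferInstance = mL := by
  refine le_antisymm (MeasurableSpace.measurable_mapNatBool L).comap_le ?_
  conv_lhs => rw [← MeasurableSpace.generateFrom_natGeneratingSequence L]
  refine MeasurableSpace.generateFrom_le ?_
  rintro _ ⟨n, rfl⟩
  refine ⟨(fun u => u n) ⁻¹' {true}, measurable_pi_apply n (measurableSet_singleton true), ?_⟩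
  ext x
  simp [MeasurableSpace.mapNatBool]

lemma comap_pi_mapNatBool (ι L : Type*) [MeasurableSpace L] [MeasurableSpace.CountablyGenerated L] :
    MeasurableSpace.comap
      (fun (y : ι → L) (p : ι × ℕ) => MeasurableSpace.mapNatBool L (y p.1) p.2) inferInstance =
        MeasurableSpace.pi := by
  have hL := comap_mapNatBool L
  simp only [MeasurableSpace.pi, MeasurableSpace.comap_iSup, MeasurableSpace.comap_comp] at hL ⊢
  simp only [iSup_prod]
  refine iSup_congr fun i => ?_
  conv_rhs => rw [← hL, MeasurableSpace.comap_iSup]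
  simp only [MeasurableSpace.comap_comp]
  rfl

lemma exists_bits_measure_ne_le {L : Type*} [MeasurableSpace L]
    [MeasurableSpace.CountablyGenerated L] (μ : Measure (ι → L)) [IsFiniteMeasure μ]
    {h : (ι → L) → A} (hh : Measurable h) {ε : ℝ≥0∞} (hε : ε ≠ 0) :
    ∃ (N : ℕ) (E : Finset ι) (g : (ι → Fin N → Bool) → A), Measurable g ∧ DependsOn g E ∧
      μ {y | h y ≠ g fun i => bits L N (y i)} ≤ ε := by
  classical
  let c (y : ι → L) (p : ι × ℕ) : Bool := MeasurableSpace.mapNatBool L (y p.1) p.2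
  have hcomap : MeasurableSpace.comap c inferInstance = MeasurableSpace.pi :=
    comap_pi_mapNatBool ι L
  have hc : Measurable c := measurable_iff_comap_le.2 hcomap.le
  obtain ⟨h', hh', rfl⟩ := (hcomap ▸ hh).exists_eq_measurable_comp
  obtain ⟨F, f, hf, hfF, hle⟩ := exists_dependsOn_measure_ne_le (μ.map c) hh' hε
  have hne : MeasurableSet {x | h' x ≠ f x} := (measurableSet_eq_fun hh' hf).compl
  rw [Measure.map_apply hc hne] at hle
  let N := F.sup Prod.snd + 1
  have hN {p : ι × ℕ} (hp : p ∈ F) : p.2 < N := Nat.lt_succ_of_le (Finset.le_sup hp)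
  let extend (u : ι → Fin N → Bool) (p : ι × ℕ) : Bool :=
    if hp : p.2 < N then u p.1 ⟨p.2, hp⟩ else false
  have hextend : Measurable extend := measurable_pi_lambda _ fun p => by
    by_cases hp : p.2 < N <;> simp only [extend, hp, dif_pos, dif_neg, not_false_eq_true] <;>
      fun_prop
  refine ⟨N, F.image Prod.fst, f ∘ extend, hf.comp hextend, fun u u' huu' => hfF fun p hp => ?_, ?_⟩
  · simp only [extend, hN hp, dif_pos, huu' p.1 (Finset.mem_coe.2 (Finset.mem_image_of_mem _ hp))]
  · have hbits (y : ι → L) : f (extend fun i => bits L N (y i)) = f (c y) :=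
      hfF fun p hp => by simp only [extend, hN hp, dif_pos, bits, c]
    simpa only [Function.comp_apply, hbits, Set.preimage_ofPred_eq] using hle

end Approximation

/-! ### Monotonicity of the base entropy -/

section Smoothing

variable {A : Type*} [Fintype A] {t : ℝ≥0∞}

/-- The mixture of a weight function with the uniform distribution, which gives every symbol a code
word of bounded length at small cost for the likely symbols. -/
noncomputable def smoothed (t : ℝ≥0∞) (p : A → ℝ≥0∞) (a : A) : ℝ≥0∞ :=
  (1 - t) * p a + t / Fintype.card A

lemma smoothed_ne_zero (ht : t ≠ 0) (p : A → ℝ≥0∞) (a : A) : smoothed t p a ≠ 0 :=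
  ne_bot_of_le_ne_bot (ENNReal.div_pos ht (ENNReal.natCast_ne_top _)).ne' le_add_self

lemma sum_smoothed_le_one (ht : t ≤ 1) {p : A → ℝ≥0∞} (hp : ∑ a, p a ≤ 1) :
    ∑ a, smoothed t p a ≤ 1 := calc
  ∑ a, smoothed t p a = (1 - t) * ∑ a, p a + Fintype.card A * (t / Fintype.card A) := by
      simp only [smoothed, Finset.sum_add_distrib, ← Finset.mul_sum, Finset.sum_const,
        Finset.card_univ, nsmul_eq_mul]
  _ ≤ (1 - t) * 1 + t := by
      gcongr
      exact ENNReal.mul_div_le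
  _ = 1 := by rw [mul_one, tsub_add_cancel_of_le ht]

lemma infoContent_smoothed_le_add (p : A → ℝ≥0∞) {a : A} (ha : p a ≤ 1) :
    infoContent (smoothed t p a) ≤ infoContent (1 - t) + infoContent (p a) := by
  rw [← infoContent_mul tsub_le_self ha]
  exact infoContent_antitone le_self_add

lemma infoContent_smoothed_le (p : A → ℝ≥0∞) (a : A) :
    infoContent (smoothed t p a) ≤ infoContent (t / Fintype.card A) :=
  infoContent_antitone le_add_self

end Smoothing

section Sofic

variable {G : Type*} [Group G]

variable {K : Type*} [MeasurableSpace K] (κ : Measure K) [IsProbabilityMeasure κ]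

lemma measure_slidingBlock_ne {B : Type*} [Countable B] [MeasurableSpace B]
    [MeasurableSingletonClass B] {β β' : (G → K) → B} (hβ : Measurable β) (hβ' : Measurable β')
    (s : G) : (Measure.infinitePi fun _ : G => κ) {x | slidingBlock β x s ≠ slidingBlock β' x s} =
      (Measure.infinitePi fun _ : G => κ) {x | β x ≠ β' x} :=
  (measurePreserving_comp_injective κ (mul_right_injective s)).measure_preimage
    (measurableSet_eq_fun hβ hβ').compl.nullMeasurableSet

lemma lintegral_slidingBlock_le {A B : Type*} [Countable B] [MeasurableSpace B]
    [MeasurableSingletonClass B] {β β' : (G → K) → B} (hβ : Measurable β) (hβ' : Measurable β')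
    {g : (G → B) → A} {E : Finset G} (hgE : DependsOn g E) (ℓ : B → A → K → ℝ≥0∞) {M : ℝ≥0∞}
    (hM : ∀ b a k, ℓ b a k ≤ M) :
    ∫⁻ x, ℓ (β' x) (g (slidingBlock β' x)) (x 1) ∂(Measure.infinitePi fun _ : G => κ) ≤
      ∫⁻ x, ℓ (β x) (g (slidingBlock β x)) (x 1) ∂(Measure.infinitePi fun _ : G => κ) +
        M * ((E.card + 1) * (Measure.infinitePi fun _ : G => κ) {x | β x ≠ β' x}) := by
  classical
  set μ := Measure.infinitePi fun _ : G => κ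
  let differ (s : G) : Set (G → K) := {x | slidingBlock β x s ≠ slidingBlock β' x s}
  set bad : Set (G → K) := ⋃ s ∈ insert 1 E, differ s
  have hbad_meas : MeasurableSet bad := Finset.measurableSet_biUnion _ fun s _ =>
    (measurableSet_eq_fun ((measurable_pi_apply s).comp (measurable_slidingBlock hβ))
      ((measurable_pi_apply s).comp (measurable_slidingBlock hβ'))).compl
  have hbad : μ bad ≤ (E.card + 1) * μ {x | β x ≠ β' x} := calc
    μ bad ≤ ∑ s ∈ insert 1 E, μ (differ s) := measure_biUnion_finset_le _ _
    _ = (insert 1 E).card * μ {x | β x ≠ β' x} := by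
        rw [Finset.sum_congr rfl fun s _ => measure_slidingBlock_ne κ hβ hβ' s, Finset.sum_const,
          nsmul_eq_mul]
    _ ≤ (E.card + 1) * μ {x | β x ≠ β' x} := by
        gcongr
        exact_mod_cast Finset.card_insert_le 1 E
  have hcost (x : G → K) : ℓ (β' x) (g (slidingBlock β' x)) (x 1) ≤
      ℓ (β x) (g (slidingBlock β x)) (x 1) + bad.indicator (fun _ => M) x := by
    by_cases hx : x ∈ bad
    · simpa only [hx, Set.indicator_of_mem] using (hM _ _ _).trans le_add_self
    · have heq : ∀ s ∈ insert 1 E, slidingBlock β x s = slidingBlock β' x s := by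
        simpa [bad, differ] using hx
      have hβx : β x = β' x := by
        simpa only [slidingBlock_one] using heq 1 (Finset.mem_insert_self 1 E)
      have hgx : g (slidingBlock β x) = g (slidingBlock β' x) :=
        hgE fun s hs => heq s (Finset.mem_insert_of_mem hs)
      rw [hβx, hgx]
      exact le_self_add
  calc ∫⁻ x, ℓ (β' x) (g (slidingBlock β' x)) (x 1) ∂μ
      ≤ ∫⁻ x, ℓ (β x) (g (slidingBlock β x)) (x 1) ∂μ + M * μ bad := by
        rw [← lintegral_indicator_const hbad_meas,
          ← lintegral_add_right _ (measurable_const.indicator hbad_meas)]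
        exact lintegral_mono hcost
    _ ≤ _ := by gcongr

section Factor

variable {A B : Type*} [Fintype A] [MeasurableSpace A] [MeasurableSingletonClass A]
  [MeasurableSpace B] [MeasurableSingletonClass B]
  {β : (G → K) → B} {g : (G → B) → A} {q : K → A}

lemma IsSofic.entropy_le_lintegral [Fintype B] (hG : IsSofic G) {w : B → ℝ≥0∞} {W : A → A → ℝ≥0∞}
    {E : Finset G} (hβ : Measurable β) (hg : Measurable g) (hgE : DependsOn g E)
    (hq : Measurable q) (hw : ∀ b, w b ≠ 0) (hw_sum : ∑ b, w b ≤ 1) (hW : ∀ c a, W c a ≠ 0)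
    (hW_sum : ∀ c, ∑ a, W c a ≤ 1) :
    entropy κ q ≤ ∫⁻ x, descriptionLength w W (β x) (g (slidingBlock β x)) (q (x 1))
      ∂(Measure.infinitePi fun _ : G => κ) := by
  have : Nonempty B := (nonempty_of_isProbabilityMeasure (Measure.infinitePi fun _ : G => κ)).map β
  obtain ⟨M, hM, hM_le⟩ := exists_descriptionLength_le hw hW
  have hcoeff : M * (E.card + 1) ≠ ⊤ :=
    ENNReal.mul_ne_top hM (by exact_mod_cast ENNReal.natCast_ne_top (E.card + 1))
  refine le_of_forall_le_add_mul hcoeff fun ε hε => ?_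
  obtain ⟨F, β', hβ', hβ'F, hle⟩ := exists_dependsOn_measure_ne_le
    (Measure.infinitePi fun _ : G => κ) hβ hε
  refine (hG.entropy_le_lintegral_of_dependsOn κ hβ' hβ'F hg hgE hq hw hw_sum hW hW_sum).trans <|
    (lintegral_slidingBlock_le κ hβ hβ' hgE (fun b a k => descriptionLength w W b a (q k))
      fun b a k => hM_le b a (q k)).trans ?_
  rw [mul_assoc]
  gcongr

lemma IsSofic.entropy_le_entropy_add [Finite B] (hG : IsSofic G) {E : Finset G}
    (hβ : Measurable β) (hg : Measurable g) (hgE : DependsOn g E) (hq : Measurable q) {t : ℝ≥0∞}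
    (ht₀ : t ≠ 0) (ht₁ : t ≤ 1) :
    entropy κ q ≤ entropy (Measure.infinitePi fun _ : G => κ) β + 2 * infoContent (1 - t) +
      infoContent (t / Fintype.card A) *
        (Measure.infinitePi fun _ : G => κ) {x | q (x 1) ≠ g (slidingBlock β x)} := by
  classical
  have := Fintype.ofFinite B
  set μ := Measure.infinitePi fun _ : G => κ
  let p (b : B) : ℝ≥0∞ := μ (β ⁻¹' {b})
  have hp_sum : ∑ b, p b = 1 := sum_measure_preimage_singleton_eq_one μ hβ
  let wrong : Set (G → K) := {x | q (x 1) ≠ g (slidingBlock β x)}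
  have hwrong : MeasurableSet wrong := (measurableSet_eq_fun (hq.comp (measurable_pi_apply 1))
    (hg.comp (measurable_slidingBlock hβ))).compl
  have hlength (x : G → K) : descriptionLength (smoothed t p) (fun c => smoothed t (Pi.single c 1))
      (β x) (g (slidingBlock β x)) (q (x 1)) ≤ infoContent (p (β x)) + 2 * infoContent (1 - t) +
        wrong.indicator (fun _ => infoContent (t / Fintype.card A)) x := by
    have hlabel : infoContent (smoothed t p (β x)) ≤ infoContent (1 - t) + infoContent (p (β x)) :=
      infoContent_smoothed_le_add p prob_le_one
    have hcorrection : infoContent (smoothed t (Pi.single (g (slidingBlock β x)) 1) (q (x 1))) ≤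
        infoContent (1 - t) + wrong.indicator (fun _ => infoContent (t / Fintype.card A)) x := by
      by_cases hx : q (x 1) = g (slidingBlock β x)
      · rw [hx]
        exact (infoContent_smoothed_le_add _ (by simp)).trans (by simp)
      · rw [Set.indicator_of_mem (s := wrong) hx]
        exact (infoContent_smoothed_le _ _).trans le_add_self
    refine (add_le_add hlabel hcorrection).trans_eq ?_
    ring
  calc entropy κ q
      ≤ ∫⁻ x, descriptionLength (smoothed t p) (fun c => smoothed t (Pi.single c 1))
          (β x) (g (slidingBlock β x)) (q (x 1)) ∂μ :=
        hG.entropy_le_lintegral κ hβ hg hgE hq (smoothed_ne_zero ht₀ p)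
          (sum_smoothed_le_one ht₁ hp_sum.le) (fun c => smoothed_ne_zero ht₀ _)
          fun c => sum_smoothed_le_one ht₁ (by simp)
    _ ≤ ∫⁻ x, (infoContent (p (β x)) + 2 * infoContent (1 - t) +
          wrong.indicator (fun _ => infoContent (t / Fintype.card A)) x) ∂μ :=
        lintegral_mono hlength
    _ = entropy μ β + 2 * infoContent (1 - t) + infoContent (t / Fintype.card A) * μ wrong := by
        rw [lintegral_add_right _ (measurable_const.indicator hwrong),
          lintegral_add_right _ measurable_const, lintegral_indicator_const hwrong,
          lintegral_const, measure_univ, mul_one]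
        rfl

end Factor

section Monotone

variable {L : Type*} [MeasurableSpace L] [MeasurableSpace.CountablyGenerated L]
  [MeasurableSingletonClass L] (lam : Measure L) [IsProbabilityMeasure lam]
  {φ : (G → K) → G → L} {ψ : (G → L) → G → K}

lemma IsSofic.entropy_le_baseEntropy_add {A : Type*} [Finite A] [MeasurableSpace A]
    [MeasurableSingletonClass A] {q : K → A} (hG : IsSofic G)
    (hφ : MeasurePreserving φ (Measure.infinitePi fun _ => κ) (Measure.infinitePi fun _ => lam))
    (hψ : Measurable ψ)
    (hφψ : ∀ᵐ x ∂(Measure.infinitePi fun _ => κ), ψ (φ x) = x ∧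
      ∀ s, φ (fun h => x (s * h)) = fun h => φ x (s * h))
    (hq : Measurable q) {t : ℝ≥0∞} (ht₀ : t ≠ 0) (ht₁ : t ≤ 1) :
    entropy κ q ≤ baseEntropy lam + 2 * infoContent (1 - t) := by
  have := Fintype.ofFinite A
  have : Nonempty A := (nonempty_of_isProbabilityMeasure κ).map q
  have hcoeff : infoContent (t / Fintype.card A) ≠ ⊤ :=
    infoContent_ne_top (ENNReal.div_ne_zero.2 ⟨ht₀, ENNReal.natCast_ne_top _⟩)
  refine le_of_forall_le_add_mul hcoeff fun ε hε => ?_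
  have hdecode : Measurable fun y => q (ψ y 1) := hq.comp ((measurable_pi_apply 1).comp hψ)
  obtain ⟨N, E, g, hg, hgE, hle⟩ :=
    exists_bits_measure_ne_le (Measure.infinitePi fun _ : G => lam) hdecode hε
  have hφ_one := (measurePreserving_eval_infinitePi (fun _ : G => lam) 1).comp hφ
  let β : (G → K) → Fin N → Bool := bits L N ∘ Function.eval 1 ∘ φ
  have hβ : Measurable β := (measurable_bits L N).comp hφ_one.measurable
  have hβ_entropy : entropy (Measure.infinitePi fun _ : G => κ) β ≤ baseEntropy lam :=
    (entropy_comp_measurePreserving hφ_one (measurable_bits L N)).trans_le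
      (entropy_le_baseEntropy lam _)
  have hwrong : (Measure.infinitePi fun _ : G => κ)
      {x | q (x 1) ≠ g (slidingBlock β x)} ≤ ε := by
    have hdiff : MeasurableSet {y | q (ψ y 1) ≠ g fun s => bits L N (y s)} :=
      (measurableSet_eq_fun hdecode (hg.comp (measurable_pi_lambda _ fun s =>
        (measurable_bits L N).comp (measurable_pi_apply s)))).compl
    rw [← hφ.measure_preimage hdiff.nullMeasurableSet] at hle
    refine (measure_mono_ae ?_).trans hle
    filter_upwards [hφψ] with x ⟨hx, hshift⟩ hne
    have hblock : slidingBlock β x = fun s => bits L N (φ x s) := funext fun s => by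
      simp only [slidingBlock, β, Function.comp_apply, hshift, Function.eval, mul_one]
    change q (ψ (φ x) 1) ≠ g fun s => bits L N (φ x s)
    rw [hx, ← hblock]
    exact hne
  exact (hG.entropy_le_entropy_add κ hβ hg hgE hq ht₀ ht₁).trans (by gcongr)

lemma IsSofic.baseEntropy_le [MeasurableSpace.CountablyGenerated K] [MeasurableSingletonClass K]
    (hG : IsSofic G)
    (hφ : MeasurePreserving φ (Measure.infinitePi fun _ => κ) (Measure.infinitePi fun _ => lam))
    (hψ : Measurable ψ)
    (hφψ : ∀ᵐ x ∂(Measure.infinitePi fun _ => κ), ψ (φ x) = x ∧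
      ∀ s, φ (fun h => x (s * h)) = fun h => φ x (s * h)) :
    baseEntropy κ ≤ baseEntropy lam := by
  have hlim : Tendsto (fun t => baseEntropy lam + 2 * infoContent (1 - t)) (𝓝[>] 0)
      (𝓝 (baseEntropy lam)) := by
    have hcont : Continuous fun t => baseEntropy lam + 2 * infoContent (1 - t) :=
      continuous_const.add <| (ENNReal.continuous_const_mul ENNReal.ofNat_ne_top).comp <|
        continuous_infoContent.comp (ENNReal.continuous_sub_left ENNReal.one_ne_top)
    have h := hcont.tendsto 0
    simp only [tsub_zero, infoContent_one, mul_zero, add_zero] at h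
    exact h.mono_left nhdsWithin_le_nhds
  rw [baseEntropy_eq_iSup_entropy_bits κ]
  refine iSup_le fun n => ge_of_tendsto hlim ?_
  filter_upwards [Ioc_mem_nhdsGT one_pos] with t ⟨ht₀, ht₁⟩
  exact hG.entropy_le_baseEntropy_add κ lam hφ hψ hφψ (measurable_bits K n) ht₀.ne' ht₁

end Monotone

end Sofic

/-! ### Conjugacies and Bernoulli shifts -/

section Conjugacy

variable {X Y : Type*} [MeasurableSpace X] [MeasurableSpace Y]

/-- The restriction of a measurable equivalence to the preimage of a set, used to transport the
conull sets on which a conjugacy is defined. -/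
def restrictPreimageEquiv (e : X ≃ᵐ Y) (s : Set Y) : (e ⁻¹' s) ≃ᵐ s where
  toEquiv := e.toEquiv.subtypeEquiv fun _ => Iff.rfl
  measurable_toFun := (e.measurable.comp measurable_subtype_coe).subtype_mk
  measurable_invFun := (e.symm.measurable.comp measurable_subtype_coe).subtype_mk

lemma measurePreserving_restrictPreimageEquiv {e : X ≃ᵐ Y} {μ : Measure X} {ν : Measure Y}
    (he : MeasurePreserving e μ ν) {s : Set Y} (hs : MeasurableSet s) :
    MeasurePreserving (restrictPreimageEquiv e s) (μ.comap Subtype.val)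
      (ν.comap Subtype.val) := by
  refine ⟨(restrictPreimageEquiv e s).measurable, Measure.ext fun t ht => ?_⟩
  rw [Measure.map_apply (restrictPreimageEquiv e s).measurable ht,
    comap_subtype_coe_apply (e.measurable hs), comap_subtype_coe_apply hs,
    ← he.measure_preimage (hs.subtype_image ht).nullMeasurableSet]
  congr 1
  ext x
  simp [restrictPreimageEquiv, Equiv.subtypeEquiv]

variable {G₁ G₂ X₁ X₂ : Type*} [Group G₁] [Group G₂] [MulAction G₁ X₁] [MulAction G₂ X₂]
  [MeasurableSpace X₁] [MeasurableSpace X₂] {Φ : G₁ ≃* G₂} {μ₁ : Measure X₁} {μ₂ : Measure X₂}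

lemma ConjugateAlong.symm (h : ConjugateAlong Φ μ₁ μ₂) : ConjugateAlong Φ.symm μ₂ μ₁ := by
  obtain ⟨S₁, S₂, φ, hS₁, hS₂, hnull₁, hnull₂, hφ, hequiv⟩ := h
  refine ⟨S₂, S₁, φ.symm, hS₂, hS₁, hnull₂, hnull₁, hφ.symm, fun g y => ?_⟩
  obtain ⟨hx, hgx⟩ := hequiv (Φ.symm g) (φ.symm y)
  rw [Φ.apply_symm_apply, φ.apply_symm_apply] at hgx
  have hy : g • (y : X₂) ∈ S₂ := hgx ▸ Subtype.coe_prop _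
  have hφ_eq : ⟨g • (y : X₂), hy⟩ = φ ⟨Φ.symm g • (φ.symm y : X₁), hx⟩ := Subtype.ext hgx.symm
  exact ⟨hy, by rw [hφ_eq, φ.symm_apply_apply]⟩

lemma ConjugateAlong.comp_measurableEquiv [MulAction G₁ X] {μ : Measure X}
    (h : ConjugateAlong Φ μ₁ μ₂) (e : X ≃ᵐ X₁) (he : MeasurePreserving e μ μ₁)
    (he_smul : ∀ (g : G₁) x, e (g • x) = g • e x) : ConjugateAlong Φ μ μ₂ := by
  obtain ⟨S₁, S₂, φ, hS₁, hS₂, hnull₁, hnull₂, hφ, hequiv⟩ := h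
  refine ⟨e ⁻¹' S₁, S₂, (restrictPreimageEquiv e S₁).trans φ, e.measurable hS₁, hS₂, ?_, hnull₂,
    hφ.comp (measurePreserving_restrictPreimageEquiv he hS₁), fun g x => ?_⟩
  · rw [← Set.preimage_compl, he.measure_preimage hS₁.compl.nullMeasurableSet, hnull₁]
  · obtain ⟨hgx, hφ_smul⟩ := hequiv g ⟨e x, x.2⟩
    refine ⟨Set.mem_preimage.2 (he_smul g x ▸ hgx), hφ_smul ▸ ?_⟩
    exact congrArg (fun y => (φ y : X₂)) (Subtype.ext (he_smul g x))

lemma exists_measurable_extend_subtype [Nonempty Y] {s : Set X} {t : Set Y} (hs : MeasurableSet s)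
    {f : s → t} (hf : Measurable f) : ∃ f' : X → Y, Measurable f' ∧ ∀ x : s, f' x = f x := by
  obtain ⟨f', hf', hff'⟩ := (MeasurableEmbedding.subtype_coe hs).exists_measurable_extend
    (measurable_subtype_coe.comp hf) fun _ => inferInstance
  exact ⟨f', hf', congrFun hff'⟩

lemma map_comap_subtype_val_of_measure_compl_eq_zero {μ : Measure X} {s : Set X}
    (hs : MeasurableSet s) (hnull : μ sᶜ = 0) :
    (μ.comap Subtype.val).map (Subtype.val : s → X) = μ := by
  rw [map_comap_subtype_coe hs, Measure.restrict_eq_self_of_ae_mem (mem_ae_iff.2 hnull)]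

lemma ConjugateAlong.exists_measurePreserving [Nonempty X₁] [Nonempty X₂]
    (h : ConjugateAlong Φ μ₁ μ₂) :
    ∃ (φ : X₁ → X₂) (ψ : X₂ → X₁), MeasurePreserving φ μ₁ μ₂ ∧ Measurable ψ ∧
      ∀ᵐ x ∂μ₁, ψ (φ x) = x ∧ ∀ g : G₁, φ (g • x) = Φ g • φ x := by
  obtain ⟨S₁, S₂, φ, hS₁, hS₂, hnull₁, hnull₂, hφ, hequiv⟩ := h
  obtain ⟨φ', hφ', hφ'_eq⟩ := exists_measurable_extend_subtype hS₁ φ.measurable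
  obtain ⟨ψ', hψ', hψ'_eq⟩ := exists_measurable_extend_subtype hS₂ φ.symm.measurable
  refine ⟨φ', ψ', ⟨hφ', ?_⟩, hψ', ?_⟩
  · have hcomp : φ' ∘ (Subtype.val : S₁ → X₁) = Subtype.val ∘ φ := funext hφ'_eq
    rw [← map_comap_subtype_val_of_measure_compl_eq_zero hS₁ hnull₁,
      Measure.map_map hφ' measurable_subtype_coe, hcomp,
      ← Measure.map_map measurable_subtype_coe φ.measurable, hφ.map_eq,
      map_comap_subtype_val_of_measure_compl_eq_zero hS₂ hnull₂]
  · filter_upwards [mem_ae_iff.2 hnull₁] with x hx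
    refine ⟨?_, fun g => ?_⟩
    · rw [hφ'_eq ⟨x, hx⟩, hψ'_eq, φ.symm_apply_apply]
    · obtain ⟨hgx, hφ_smul⟩ := hequiv g ⟨x, hx⟩
      rw [hφ'_eq ⟨x, hx⟩, ← hφ_smul, ← hφ'_eq]

end Conjugacy

section Bernoulli

lemma bernoulli_inv_smul {G K : Type*} [Group G] (s : G) (x : BernoulliSpace G K) :
    s⁻¹ • x = fun h => x (s * h) :=
  funext fun h => congrArg (fun r => x (r * h)) (inv_inv s)

variable {G K L : Type*} [Group G] [MeasurableSpace K] [MeasurableSpace L]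

lemma IsSofic.baseEntropy_le_of_conjugateAlong {G' : Type*} [Group G'] [StandardBorelSpace K]
    [StandardBorelSpace L] (κ : Measure K) [IsProbabilityMeasure κ] (lam : Measure L)
    [IsProbabilityMeasure lam] (hG : IsSofic G) {Φ : G ≃* G'}
    (h : ConjugateAlong Φ (bernoulliMeasure G κ) (bernoulliMeasure G' lam)) :
    baseEntropy κ ≤ baseEntropy lam := by
  have : Nonempty (BernoulliSpace G K) := (nonempty_of_isProbabilityMeasure κ).map fun k _ => k
  have : Nonempty (BernoulliSpace G' L) := (nonempty_of_isProbabilityMeasure lam).map fun l _ => l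
  obtain ⟨φ, ψ, hφ, hψ, hφψ⟩ := h.exists_measurePreserving
  refine hG.baseEntropy_le κ lam (φ := fun x => φ x ∘ Φ) (ψ := fun y => ψ (y ∘ Φ.symm))
    ((measurePreserving_comp_injective lam Φ.injective).comp hφ)
    (hψ.comp (measurable_pi_lambda _ fun h => measurable_pi_apply (Φ.symm h))) ?_
  filter_upwards [hφψ] with x ⟨hx, hequiv⟩
  refine ⟨?_, fun s => funext fun h => ?_⟩
  · have hΦ : (φ x ∘ Φ) ∘ Φ.symm = φ x := funext fun h => congrArg (φ x) (Φ.apply_symm_apply h)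
    exact (congrArg ψ hΦ).trans hx
  · have hshift : φ (fun h => x (s * h)) = fun k => φ x (Φ s * k) := by
      rw [← bernoulli_inv_smul (Φ s) (φ x : BernoulliSpace G' L), ← map_inv]
      exact (congrArg φ (bernoulli_inv_smul s x)).symm.trans (hequiv s⁻¹)
    exact (congrFun hshift (Φ h)).trans (congrArg (φ x) (map_mul Φ s h).symm)

lemma ConjugateAlong.of_bernoulli_map {G₂ X₂ : Type*} [Group G₂] [MulAction G₂ X₂]
    [MeasurableSpace X₂] {μ₂ : Measure X₂} {Φ : G ≃* G₂} (κ : Measure K) [IsProbabilityMeasure κ]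
    (e : K ≃ᵐ L)
    (h : ConjugateAlong Φ (bernoulliMeasure G (κ.map e)) μ₂) :
    ConjugateAlong Φ (bernoulliMeasure G κ) μ₂ :=
  h.comp_measurableEquiv (MeasurableEquiv.piCongrRight fun _ => e)
    ⟨MeasurableEquiv.measurable _, Measure.infinitePi_map_pi _ fun _ => e.measurable⟩
    fun _ _ => rfl

lemma exists_measurableEquiv_real_subset (K : Type*) [MeasurableSpace K] [StandardBorelSpace K] :
    ∃ s : Set ℝ, MeasurableSet s ∧ Nonempty (K ≃ᵐ s) :=
  have h := measurableEmbedding_embeddingReal K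
  ⟨_, h.measurableSet_range, ⟨h.equivRange⟩⟩

lemma IsOrnstein.isomorphic (hG : IsOrnstein G) [StandardBorelSpace K] [StandardBorelSpace L]
    (κ : Measure K) [IsProbabilityMeasure κ] (lam : Measure L) [IsProbabilityMeasure lam]
    (h : baseEntropy κ = baseEntropy lam) :
    Isomorphic G (bernoulliMeasure G κ) (bernoulliMeasure G lam) := by
  obtain ⟨s, hs, ⟨e⟩⟩ := exists_measurableEquiv_real_subset K
  obtain ⟨t, ht, ⟨f⟩⟩ := exists_measurableEquiv_real_subset L
  have := hs.standardBorel
  have := ht.standardBorel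
  have := Measure.isProbabilityMeasure_map (μ := κ) e.measurable.aemeasurable
  have := Measure.isProbabilityMeasure_map (μ := lam) f.measurable.aemeasurable
  have hreal : Isomorphic G (bernoulliMeasure G (κ.map e)) (bernoulliMeasure G (lam.map f)) :=
    hG _ _ _ _ (by rw [baseEntropy_map_measurableEquiv, baseEntropy_map_measurableEquiv, h])
  exact (hreal.of_bernoulli_map κ e).symm.of_bernoulli_map lam f |>.symm

end Bernoulli

end SoficBernoulli

theorem mainTheorem7 {G : Type*} [Group G] [Countable G]
    (hsofic : SoficBernoulli.IsSofic G) (hornstein : SoficBernoulli.IsOrnstein G)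
    {K₁ K₂ : Type*} [MeasurableSpace K₁] [StandardBorelSpace K₁]
    [MeasurableSpace K₂] [StandardBorelSpace K₂]
    (κ₁ : MeasureTheory.Measure K₁) [MeasureTheory.IsProbabilityMeasure κ₁]
    (κ₂ : MeasureTheory.Measure K₂) [MeasureTheory.IsProbabilityMeasure κ₂] :
    SoficBernoulli.ConjugateUpToAutomorphisms G G
        (SoficBernoulli.bernoulliMeasure G κ₁) (SoficBernoulli.bernoulliMeasure G κ₂) ↔
      SoficBernoulli.baseEntropy κ₁ = SoficBernoulli.baseEntropy κ₂ := by
  refine ⟨fun ⟨Φ, h⟩ => ?_, fun h => ⟨MulEquiv.refl G, hornstein.isomorphic κ₁ κ₂ h⟩⟩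
  exact le_antisymm (hsofic.baseEntropy_le_of_conjugateAlong κ₁ κ₂ h)
    (hsofic.baseEntropy_le_of_conjugateAlong κ₂ κ₁ h.symm)
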